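/- Let $(X,d)$ be a metric space. For $A\subseteq X$ let $\operatorname{diam}A=\sup\{d(a,a'):a,a'\in A\}\in[0,\infty]$ (with $\operatorname{diam}\emptyset=0$), and let $$L^*(A)=\sup_{\delta>0}\ \inf\Big\{\sum_{i\in\mathbb N}\operatorname{diam}(U_i)\ :\ A\subseteq\bigcup_{i\in\mathbb N}U_i,\ U_i\subseteq X,\ \operatorname{diam}(U_i)\le\delta\text{ for all }i\Big\}\in[0,\infty]$$ be its outer linear measure (one-dimensional Hausdorff outer measure). A set $A\subseteq X$ \emph{hits} a collection $\mathscr U$ of subsets of $X$ if $A\cap U\neq\emptyset$ for all $U\in\mathscr U$. For $A,B\subseteq X$ let $e(A,B)=\sup_{a\in A}\inf_{b\in B}d(a,b)\in[0,\infty]$, where $\sup\emptyset=0$ and $\inf\emptyset=\infty$. The empty set is counted as connected. \textbf{Main statement.} Let $A\subseteq X$. (1) If $L^*(A)<\infty$, then for every $\varepsilon>0$ there is a finite collection $\mathscr U$ of open subsets of $X$ hit by $A$ such that every connected $B\subseteq X$ that hits $\mathscr U$ satisfies $L^*(A)<L^*(B)+\varepsilon$. (2) If $L^*(A)=\infty$,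 then for every $M>0$ there is a finite collection $\mathscr U$ of open subsets of $X$ hit by $A$ such that every connected $B\subseteq X$ that hits $\mathscr U$ satisfies $L^*(B)>M$. Moreover, the following hold. (3) (Lower semicontinuity.) Equip the power set of $X$ with the lower Vietoris topology, generated by the sets $\{S\subseteq X: S\cap U\neq\emptyset\}$ with $U\subseteq X$ open. Then $L^*$ is lower semicontinuous on the subspace of connected subsets of $X$. (4) (Gołąb.) If $A\subseteq X$ and $(A_n)_{n\in\mathbb N}$ is a sequence of connected subsets of $X$ with $\lim_{n\to\infty}e(A,A_n)=0$, then $L^*(A)\le\liminf_{n\to\infty}L^*(A_n)$. (5) (Frink.) Let $A\subseteq X$. If $L^*(A)<\infty$, then for every $\varepsilon>0$ there is $\delta>0$ such that every connected $B\subseteq X$ with $e(A,B)<\delta$ satisfies $L^*(A)<L^*(B)+\varepsilon$. If $L^*(A)=\infty$, then for every $M>0$ there is $\delta>0$ such that every connected $B\subseteq X$ with $e(A,B)<\delta$ satisfies $L^*(B)>M$. (6) (Bognár.) Let $(A_\lambda)_{\lambda\in\Lambda}$ be a net of connected subsets of $X$, indexed by a nonempty directed set $(\Lambda,\preccurlyeq)$,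 and let $\operatorname{Li}A_\lambda$ be its lower limit, the set of all $x\in X$ such that for every $\varepsilon>0$ there is $\lambda_0\in\Lambda$ with $A_\lambda\cap B(x,\varepsilon)\neq\emptyset$ for all $\lambda\succcurlyeq\lambda_0$, where $B(x,\varepsilon)$ is the open ball. Then $L^*(\operatorname{Li}A_\lambda)\le\liminf_\lambda L^*(A_\lambda)$. (7) (Fremlin.) Let $A\subseteq X$ and let $\alpha\ge 0$ be a real number. If for every finite collection $\mathscr U$ of open subsets of $X$ hit by $A$ there is a connected $C\subseteq X$ that hits $\mathscr U$ and satisfies $L^*(C)\le\alpha$, then $L^*(A)\le\alpha$. -/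

import Mathlib

open Filter Topology
open scoped ENNReal NNReal MeasureTheory

namespace Golab

noncomputable section

/-- `L*_δ(A)`: the infimum of `∑ diam (U i)` over all covers of `A` by a sequence of sets of
diameter at most `δ`. Diameters take values in `[0, ∞]`, and `diam ∅ = 0`. -/
def outerLinearPre {X : Type*} [MetricSpace X] (δ : ℝ) (A : Set X) : ℝ≥0∞ :=
  ⨅ (U : ℕ → Set X) (_ : A ⊆ ⋃ i, U i) (_ : ∀ i, Metric.ediam (U i) ≤ ENNReal.ofReal δ),
    ∑' i, Metric.ediam (U i)

/-- The outer linear measure `L*(A) = sup_{δ > 0} L*_δ(A)` of an arbitrary subset of a metric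
space (the one-dimensional Hausdorff outer measure). -/
def outerLinear {X : Type*} [MetricSpace X] (A : Set X) : ℝ≥0∞ :=
  ⨆ (δ : ℝ) (_ : 0 < δ), outerLinearPre δ A

/-- `L*` is Mathlib's one-dimensional Hausdorff measure, evaluated on arbitrary sets. -/
theorem outerLinear_eq_hausdorffMeasure {X : Type*} [MetricSpace X] [MeasurableSpace X]
    [BorelSpace X] (A : Set X) : outerLinear A = μH[1] A := by
  have key : ∀ s : Set X, (⨆ _ : s.Nonempty, Metric.ediam s ^ (1 : ℝ)) = Metric.ediam s := by
    intro s
    rcases s.eq_empty_or_nonempty with rfl | h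
    · simp
    · simp [h]
  rw [MeasureTheory.Measure.hausdorffMeasure_apply]
  simp only [key]
  unfold outerLinear outerLinearPre
  apply le_antisymm
  · refine iSup₂_le fun δ hδ => ?_
    exact le_iSup₂_of_le (ENNReal.ofReal δ) (ENNReal.ofReal_pos.2 hδ) le_rfl
  · refine iSup₂_le fun r hr => ?_
    obtain ⟨δ, hδ0, hδ⟩ : ∃ δ : ℝ, 0 < δ ∧ ENNReal.ofReal δ ≤ r := by
      rcases eq_or_ne r ∞ with rfl | h
      · exact ⟨1, one_pos, le_top⟩
      · exact ⟨r.toReal, ENNReal.toReal_pos hr.ne' h, ENNReal.ofReal_toReal_le⟩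
    refine le_iSup₂_of_le δ hδ0 ?_
    refine le_iInf fun U => le_iInf fun hU => le_iInf fun hd => ?_
    exact iInf_le_of_le U (iInf_le_of_le hU (iInf_le_of_le (fun i => (hd i).trans hδ) le_rfl))

/-- A set hits a collection of sets if it meets every member of the collection. -/
def Hits {X : Type*} (A : Set X) (𝓤 : Set (Set X)) : Prop :=
  ∀ U ∈ 𝓤, (A ∩ U).Nonempty

/-- The excess `e(A, B) = sup_{a ∈ A} d(a, B)` of `A` over `B`, with values in `[0, ∞]`;
`d(a, ∅) = ∞` and `e(∅, B) = 0`. -/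
def excess {X : Type*} [MetricSpace X] (A B : Set X) : ℝ≥0∞ :=
  ⨆ a ∈ A, Metric.infEDist a B

/-- The (Painlevé–Kuratowski) lower limit of a net of sets: the points each of whose
neighbourhoods is eventually met by the net. -/
def lowerLimit {X : Type*} [MetricSpace X] {Λ : Type*} [Preorder Λ] (A : Λ → Set X) : Set X :=
  {x | ∀ ε : ℝ, 0 < ε → ∃ l₀ : Λ, ∀ l, l₀ ≤ l → (A l ∩ Metric.ball x ε).Nonempty}

/-- The lower Vietoris topology on the set of all subsets of `X`, generated by the sets
`{S | S ∩ U ≠ ∅}` with `U` open. -/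
@[reducible]
def lowerVietoris (X : Type*) [TopologicalSpace X] : TopologicalSpace (Set X) :=
  TopologicalSpace.generateFrom {𝓢 | ∃ U : Set X, IsOpen U ∧ 𝓢 = {S | (S ∩ U).Nonempty}}

end

end Golab

namespace Golab

/-! All parts follow from `exists_finite_hits_lt`: a bound `a < L*(A)` is passed on to every
connected set hitting finitely many suitable balls centred in `A`. The heart is uniformity. A
connected `B` with `L*(B) ≤ α` may need infinitely many small sets in a cheap cover, yet
`exists_cover_of_near_isPreconnected` covers every finite set near `B` by `N` small sets of total
diameter at most `α + κ`, with `N` independent of `B`. For this, chains of intersecting cover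
members are merged into disjoint blocks, chosen greedily: while some point of `B` is farther than `t
j` from the first `j` blocks, connectedness yields a new block of weight at least `t j`. With `t j =
κ / (8 j)` the harmonic series diverges, so the selection stops at some `m` below a uniform bound;
since `m * t m ≤ κ / 8`, thickening the blocks to catch all of `B` costs little. As `N` is fixed, an
ultrafilter limit (`outerLinearPre_le_of_finite`) turns such covers of all finite subsets of `A`
into one of `A`. Hence if `a < L*(A)`, some finite `F ⊆ A` has no such cover, and balls around `F`
do the job. -/

/-- In an open cover of a preconnected set, any two members that meet the set are joined by a chain
of members in which consecutive ones meet. -/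
theorem reflTransGen_of_isPreconnected {X ι : Type*} [TopologicalSpace X] {B : Set X}
    (hB : IsPreconnected B) {U : ι → Set X} (hU : ∀ i, IsOpen (U i)) (hBU : B ⊆ ⋃ i, U i) {i j : ι}
    (hi : (B ∩ U i).Nonempty) (hj : (B ∩ U j).Nonempty) :
    Relation.ReflTransGen (fun a b => (U a ∩ U b).Nonempty) i j := by
  by_contra hij
  set R := Relation.ReflTransGen (fun a b => (U a ∩ U b).Nonempty) i with hR
  -- The members reachable from `i` and the others have open unions that together cover `B` and both
  -- meet `B`; a common point would prolong a chain to an unreachable member.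
  obtain ⟨x, -, hx⟩ := hB (⋃ k ∈ {k | R k}, U k) (⋃ k ∈ {k | ¬ R k}, U k)
    (isOpen_biUnion fun k _ => hU k) (isOpen_biUnion fun k _ => hU k)
    (fun x hx => by
      obtain ⟨k, hk⟩ := Set.mem_iUnion.1 (hBU hx)
      by_cases h : R k
      · exact Or.inl (Set.mem_biUnion (show k ∈ {k | R k} from h) hk)
      · exact Or.inr (Set.mem_biUnion (show k ∈ {k | ¬ R k} from h) hk))
    (hi.mono (Set.inter_subset_inter_right _
      (Set.subset_biUnion_of_mem (u := U) (show i ∈ {k | R k} from .refl))))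
    (hj.mono (Set.inter_subset_inter_right _
      (Set.subset_biUnion_of_mem (u := U) (show j ∈ {k | ¬ R k} from hij))))
  obtain ⟨h₁, h₂⟩ := hx
  simp only [Set.mem_iUnion, Set.mem_ofPred_eq, exists_prop] at h₁ h₂
  obtain ⟨a, ha, hxa⟩ := h₁
  obtain ⟨b, hb, hxb⟩ := h₂
  exact hb (ha.tail ⟨x, hxa, hxb⟩)

/-! ### Blocks of a cover and their greedy selection -/

/-- A finite set of indices whose members have a union of diameter at most the sum of their
diameters, this sum being at most `r`. -/
structure IsBlock {X ι : Type*} [MetricSpace X] (U : ι → Set X) (r : ℝ≥0∞) (G : Finset ι) :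
    Prop where
  ediam_le : Metric.ediam (⋃ i ∈ G, U i) ≤ ∑ i ∈ G, Metric.ediam (U i)
  sum_le : ∑ i ∈ G, Metric.ediam (U i) ≤ r

theorem isBlock_singleton {X ι : Type*} [MetricSpace X] {U : ι → Set X} {r : ℝ≥0∞} {i : ι}
    (h : Metric.ediam (U i) ≤ r) : IsBlock U r {i} :=
  ⟨by simp, by simpa⟩

/-- Along a chain of sets starting at `i`, a block containing `i` and avoiding `F` can be grown
until it has weight at least `c`, or touches `F`, or reaches the end of the chain. -/
theorem exists_isBlock_of_reflTransGen {X ι : Type*} [MetricSpace X] {U : ι → Set X} {c : ℝ≥0∞}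
    (hc : c ≠ ∞) (hUc : ∀ i, Metric.ediam (U i) ≤ c) {F : Finset ι} {i j : ι} (hi : i ∉ F)
    (hij : Relation.ReflTransGen (fun a b => (U a ∩ U b).Nonempty) i j) :
    ∃ G : Finset ι, i ∈ G ∧ Disjoint G F ∧ IsBlock U (2 * c) G ∧
      (c ≤ ∑ k ∈ G, Metric.ediam (U k) ∨ j ∈ G ∨
        ∃ a ∈ G, ∃ b ∈ F, (U a ∩ U b).Nonempty) := by
  classical
  induction hij with
  | refl =>
    exact ⟨{i}, by simp, by simpa, isBlock_singleton ((hUc i).trans (by rw [two_mul]; simp)),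
      by simp⟩
  | @tail j k _ hjk ih =>
    obtain ⟨G, hiG, hGF, hG, h⟩ := ih
    rcases h with h | h | h
    · exact ⟨G, hiG, hGF, hG, Or.inl h⟩
    · by_cases hkG : k ∈ G
      · exact ⟨G, hiG, hGF, hG, Or.inr (Or.inl hkG)⟩
      by_cases hkF : k ∈ F
      · exact ⟨G, hiG, hGF, hG, Or.inr (Or.inr ⟨j, h, k, hkF, hjk⟩)⟩
      -- If adding `U k` would exceed `2 * c`, then `G` already weighs at least `c`, because `U k`
      -- contributes at most `c`.
      by_cases hs : Metric.ediam (U k) + ∑ a ∈ G, Metric.ediam (U a) ≤ 2 * c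
      · refine ⟨insert k G, by simp [hiG], by simp [hkF, hGF], ⟨?_, ?_⟩, by simp⟩
        · rw [Finset.set_biUnion_insert, Finset.sum_insert hkG]
          refine (Metric.ediam_union_le ?_).trans (add_le_add le_rfl hG.ediam_le)
          obtain ⟨x, hxj, hxk⟩ := hjk
          exact ⟨x, hxk, Set.mem_biUnion h hxj⟩
        · rwa [Finset.sum_insert hkG]
      · refine ⟨G, hiG, hGF, hG, Or.inl ?_⟩
        rw [not_le, two_mul] at hs
        have := hs.trans_le (add_le_add (hUc k) le_rfl)
        exact ((ENNReal.add_lt_add_iff_left hc).1 this).le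
    · exact ⟨G, hiG, hGF, hG, Or.inr (Or.inr h)⟩

/-- A point of a preconnected set at distance more than `t ≤ c` from the members indexed by `F`
of an open cover lies in a block of weight at least `t` that avoids `F`. -/
theorem exists_isBlock_of_far {X ι : Type*} [MetricSpace X] {B : Set X} (hB : IsPreconnected B)
    {U : ι → Set X} (hU : ∀ i, IsOpen (U i)) (hBU : B ⊆ ⋃ i, U i) {c t : ℝ≥0∞}
    (hc : c ≠ ∞) (htc : t ≤ c) (hUc : ∀ i, Metric.ediam (U i) ≤ c) {F : Finset ι}
    (hF : ∃ j ∈ F, (B ∩ U j).Nonempty) {y : X} (hy : y ∈ B)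
    (hyF : ∀ j ∈ F, ∀ z ∈ U j, t < edist y z) :
    ∃ G : Finset ι, Disjoint G F ∧ IsBlock U (2 * c) G ∧ t ≤ ∑ k ∈ G, Metric.ediam (U k) := by
  obtain ⟨i, hyi⟩ := Set.mem_iUnion.1 (hBU hy)
  obtain ⟨j, hjF, hj⟩ := hF
  have hiF : i ∉ F := fun h => absurd (hyF i h y hyi) (by simp)
  obtain ⟨G, hiG, hGF, hG, h⟩ := exists_isBlock_of_reflTransGen hc hUc hiF
    (reflTransGen_of_isPreconnected hB hU hBU ⟨y, hy, hyi⟩ hj)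
  refine ⟨G, hGF, hG, ?_⟩
  -- The chain ends in `F`, which `G` avoids. If `G` touches `F`, it joins `y` to a point farther
  -- than `t` away, so its diameter, and hence its weight, is at least `t`.
  rcases h with h | h | ⟨a, haG, b, hbF, z, hza, hzb⟩
  · exact htc.trans h
  · exact absurd hjF (Finset.disjoint_left.1 hGF h)
  · exact (hyF b hbF z hzb).le.trans ((Metric.edist_le_ediam_of_mem (Set.mem_biUnion hiG hyi)
      (Set.mem_biUnion haG hza)).trans hG.ediam_le)

/-- Greedy selection of disjoint blocks: if the thresholds `t j` sum to more than the total weight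
of the cover, then some `m` disjoint blocks come within `t m` of every point of `B`. -/
theorem exists_blocks {X ι : Type*} [MetricSpace X] {B : Set X} (hB : IsPreconnected B)
    (hBne : B.Nonempty) {U : ι → Set X} (hU : ∀ i, IsOpen (U i)) (hBU : B ⊆ ⋃ i, U i) {c : ℝ≥0∞}
    (hc : c ≠ ∞) (hUc : ∀ i, Metric.ediam (U i) ≤ c) {t : ℕ → ℝ≥0∞} (ht0 : t 0 = 0)
    (htc : ∀ j, t j ≤ c) {K : ℕ}
    (hK : ∑' i, Metric.ediam (U i) < ∑ j ∈ Finset.range K, t j) :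
    ∃ m < K, ∃ G : ℕ → Finset ι, (∀ j < m, IsBlock U (2 * c) (G j)) ∧
      (∑ j ∈ Finset.range m, ∑ i ∈ G j, Metric.ediam (U i) ≤ ∑' i, Metric.ediam (U i)) ∧
      ∀ y ∈ B, ∃ j < m, ∃ i ∈ G j, ∃ z ∈ U i, edist y z ≤ t m := by
  classical
  have weight_le : ∀ (m : ℕ) (G : ℕ → Finset ι),
      ((Finset.range m : Set ℕ).PairwiseDisjoint G) →
      ∑ j ∈ Finset.range m, ∑ i ∈ G j, Metric.ediam (U i) ≤ ∑' i, Metric.ediam (U i) := by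
    intro m G hG
    rw [← Finset.sum_biUnion hG]
    exact ENNReal.sum_le_tsum _
  by_contra hcon
  push Not at hcon
  -- The initial block is a single member meeting `B`, so that later chains have a target; its
  -- weight may be tiny, which `t 0 = 0` permits.
  have key : ∀ m : ℕ, m + 1 ≤ K → ∃ G : ℕ → Finset ι, (∀ j < m + 1, IsBlock U (2 * c) (G j)) ∧
      ((Finset.range (m + 1) : Set ℕ).PairwiseDisjoint G) ∧ (∃ i ∈ G 0, (B ∩ U i).Nonempty) ∧
      ∑ j ∈ Finset.range (m + 1), t j ≤
        ∑ j ∈ Finset.range (m + 1), ∑ i ∈ G j, Metric.ediam (U i) := by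
    intro m
    induction m with
    | zero =>
      intro _
      obtain ⟨x, hx⟩ := hBne
      obtain ⟨i, hi⟩ := Set.mem_iUnion.1 (hBU hx)
      refine ⟨fun _ => {i}, fun _ _ => isBlock_singleton ((hUc i).trans (by rw [two_mul]; simp)),
        by simp, ⟨i, by simp, x, hx, hi⟩, by simp [ht0]⟩
    | succ m ih =>
      intro hm
      obtain ⟨G, hG, hdisj, ⟨i₀, hi₀, hBi₀⟩, hsum⟩ := ih (by omega)
      obtain ⟨y, hyB, hy⟩ := hcon (m + 1) (by omega) G hG (weight_le _ G hdisj)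
      obtain ⟨H, hHF, hH, htH⟩ := exists_isBlock_of_far hB hU hBU hc (htc (m + 1)) hUc
        (F := (Finset.range (m + 1)).biUnion G)
        ⟨i₀, Finset.mem_biUnion.2 ⟨0, by simp, hi₀⟩, hBi₀⟩ hyB
        (fun j hj z hz => by
          obtain ⟨k, hk, hjk⟩ := Finset.mem_biUnion.1 hj
          exact hy k (Finset.mem_range.1 hk) j hjk z hz)
      have hne : ∀ j < m + 1, Function.update G (m + 1) H j = G j := fun j hj =>
        Function.update_of_ne hj.ne _ _
      have hHG : ∀ j < m + 1, Disjoint H (G j) := fun j hj =>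
        hHF.mono_right (Finset.subset_biUnion_of_mem G (Finset.mem_range.2 hj))
      refine ⟨Function.update G (m + 1) H, fun j hj => ?_, ?_, ?_, ?_⟩
      · rcases Nat.lt_succ_iff_lt_or_eq.1 hj with h | rfl
        · rw [hne j h]; exact hG j h
        · simpa using hH
      · intro a ha b hb hab
        simp only [Finset.coe_range, Set.mem_Iio] at ha hb
        show Disjoint (Function.update G (m + 1) H a) (Function.update G (m + 1) H b)
        rcases Nat.lt_succ_iff_lt_or_eq.1 ha with h | rfl
        · rcases Nat.lt_succ_iff_lt_or_eq.1 hb with h' | rfl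
          · rw [hne a h, hne b h']
            exact hdisj (by simpa using h) (by simpa using h') hab
          · rw [hne a h, Function.update_self]; exact (hHG a h).symm
        · have h' : b < m + 1 := by omega
          rw [hne b h', Function.update_self]; exact hHG b h'
      · rw [hne 0 (by omega)]; exact ⟨i₀, hi₀, hBi₀⟩
      · rw [Finset.sum_range_succ, Finset.sum_range_succ _ (m + 1), Function.update_self]
        refine add_le_add (hsum.trans (Finset.sum_le_sum fun j hj => ?_)) htH
        rw [hne j (Finset.mem_range.1 hj)]
  cases K with
  | zero => simp at hK
  | succ m =>
    obtain ⟨G, -, hdisj, -, hsum⟩ := key m le_rfl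
    exact absurd (hK.trans_le (hsum.trans (weight_le _ G hdisj))) (lt_irrefl _)

/-! ### Uniform covers near connected sets of bounded length -/

/-- Open covers by small sets almost realize the outer linear measure. -/
theorem exists_open_cover {X : Type*} [MetricSpace X] {B : Set X} {α : ℝ≥0}
    (hB : outerLinear B ≤ α) {r : ℝ≥0} (hr : 0 < r) :
    ∃ U : ℕ → Set X, (∀ i, IsOpen (U i)) ∧ B ⊆ ⋃ i, U i ∧ (∀ i, Metric.ediam (U i) ≤ 3 * r) ∧
      ∑' i, Metric.ediam (U i) ≤ α + 3 * r := by
  have h : outerLinearPre r B < α + r :=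
    ((le_iSup₂ (f := fun δ (_ : 0 < δ) => outerLinearPre δ B) (r : ℝ) hr).trans hB).trans_lt
      (ENNReal.lt_add_right (by simp) (by simpa using hr.ne'))
  simp only [outerLinearPre, iInf_lt_iff] at h
  obtain ⟨V, hBV, hVd, hVs⟩ := h
  rw [ENNReal.ofReal_coe_nnreal] at hVd
  -- Thickening radii with sum below `r` make the cover open and add at most `2 * r` in total.
  obtain ⟨s, hs, hsum⟩ := ENNReal.exists_pos_sum_of_countable
    (ENNReal.coe_ne_zero.2 hr.ne') ℕ
  have hd : ∀ i, Metric.ediam (Metric.thickening (s i) (V i)) ≤ Metric.ediam (V i) + 2 * s i :=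
    fun i => Metric.ediam_thickening_le (s i)
  refine ⟨fun i => Metric.thickening (s i) (V i), fun i => Metric.isOpen_thickening,
    hBV.trans (Set.iUnion_mono fun i => Metric.self_subset_thickening (hs i) _),
    fun i => (hd i).trans ?_, ?_⟩
  · have : (s i : ℝ≥0∞) ≤ r := (ENNReal.le_tsum i).trans hsum.le
    calc Metric.ediam (V i) + 2 * s i ≤ r + 2 * r := by gcongr; exact hVd i
      _ = 3 * r := by ring
  · calc ∑' i, Metric.ediam (Metric.thickening (s i) (V i))
        ≤ ∑' i, (Metric.ediam (V i) + 2 * s i) := ENNReal.tsum_le_tsum hd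
      _ = ∑' i, Metric.ediam (V i) + 2 * ∑' i, (s i : ℝ≥0∞) := by
        rw [ENNReal.tsum_add, ENNReal.tsum_mul_left]
      _ ≤ (α + r) + 2 * r := by gcongr
      _ = α + 3 * r := by ring

/-- Finite sets close to a connected set of length at most `α` are covered by a bounded number of
sets of diameter at most `κ` with total diameter at most `α + κ`; the bound and the required
closeness do not depend on the connected set. -/
theorem exists_cover_of_near_isPreconnected (X : Type*) [MetricSpace X] (α : ℝ≥0) {κ : ℝ≥0}
    (hκ : 0 < κ) :
    ∃ (N : ℕ) (η : ℝ≥0), 0 < η ∧ ∀ B : Set X, IsPreconnected B → outerLinear B ≤ α →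
      ∀ F : Set X, (∀ x ∈ F, (B ∩ Metric.ball x η).Nonempty) →
        ∃ S : ℕ → Set X, F ⊆ ⋃ i ∈ Finset.range N, S i ∧ (∀ i, Metric.ediam (S i) ≤ κ) ∧
          ∑ i ∈ Finset.range N, Metric.ediam (S i) ≤ α + κ := by
  classical
  -- The left side bounds the weight of the open cover used below. The term `j = 0` vanishes, since
  -- division by zero gives zero.
  obtain ⟨K, hK⟩ : ∃ K : ℕ, α + 3 * (κ / 24) < ∑ j ∈ Finset.range K, κ / 8 / (j : ℝ≥0) := by
    have h : Tendsto (fun n : ℕ => ∑ j ∈ Finset.range n, ((j : ℝ))⁻¹) atTop atTop :=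
      (not_summable_iff_tendsto_nat_atTop_of_nonneg (fun n => by positivity)).1
        Real.not_summable_natCast_inv
    have hκ' : (0 : ℝ) < κ := hκ
    obtain ⟨K, hK⟩ := (h.eventually_gt_atTop ((α + 3 * (κ / 24)) / (κ / 8))).exists
    refine ⟨K, ?_⟩
    rw [div_lt_iff₀ (by positivity), Finset.sum_mul] at hK
    rw [← NNReal.coe_lt_coe]
    push_cast
    refine hK.trans_eq (Finset.sum_congr rfl fun j _ => ?_)
    rw [div_eq_mul_inv (κ / 8 : ℝ), mul_comm]
  set η : ℝ≥0 := κ / (8 * (K + 1)) with hη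
  refine ⟨K, η, by positivity, fun B hB hBα F hF => ?_⟩
  -- Only a nonempty `F` forces `B` to be nonempty, as the block selection requires.
  rcases F.eq_empty_or_nonempty with rfl | ⟨x₀, hx₀⟩
  · exact ⟨fun _ => ∅, by simp, by simp, by simp⟩
  obtain ⟨U, hU, hBU, hUd, hUs⟩ := exists_open_cover hBα (r := κ / 24) (by positivity)
  set t : ℕ → ℝ≥0 := fun j => κ / 8 / (j : ℝ≥0) with htdef
  have ht : ∀ j, t j ≤ κ / 8 := fun j => by
    rcases Nat.eq_zero_or_pos j with rfl | hj
    · simp [htdef]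
    · exact div_le_self (by positivity) (by exact_mod_cast hj)
  have hc : (3 : ℝ≥0∞) * ((κ / 24 : ℝ≥0) : ℝ≥0∞) = ((κ / 8 : ℝ≥0) : ℝ≥0∞) := by
    have : (3 : ℝ≥0) * (κ / 24) = κ / 8 := by
      rw [← NNReal.coe_inj]; push_cast; ring
    rw [← this]; simp
  rw [hc] at hUd hUs
  obtain ⟨m, hmK, G, hG, hGs, hGT⟩ := exists_blocks hB
    ((hF x₀ hx₀).mono Set.inter_subset_left) hU hBU ENNReal.coe_ne_top hUd
    (t := fun j => (t j : ℝ≥0∞)) (by simp [htdef]) (fun j => by exact_mod_cast ht j) (K := K)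
    (hUs.trans_lt (by
      rw [← hc]
      exact_mod_cast hK))
  have hηκ : η ≤ κ / 8 := by
    rw [hη, ← div_div]
    exact div_le_self (by positivity) (by simp)
  have hKη : (K : ℝ≥0) * η ≤ κ / 8 := by
    rw [hη, ← div_div, ← mul_div_assoc, mul_comm, mul_div_assoc]
    exact mul_le_of_le_one_right (by positivity) (div_le_one_of_le₀ (by simp) (by positivity))
  have hmt : (m : ℝ≥0) * t m ≤ κ / 8 := by
    rw [htdef]
    rcases Nat.eq_zero_or_pos m with rfl | hm
    · simp
    · have hm' : (m : ℝ≥0) ≠ 0 := by exact_mod_cast hm.ne'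
      exact (mul_div_cancel₀ _ hm').le
  -- Padding with empty sets replaces the variable number `m` of blocks by the uniform `K`.
  set S : ℕ → Set X := fun j => if j < m then
    Metric.cthickening (t m + η) (⋃ i ∈ G j, U i) else ∅ with hS
  have hSd : ∀ j < m, Metric.ediam (S j) ≤
      ∑ i ∈ G j, Metric.ediam (U i) + 2 * ((t m + η : ℝ≥0) : ℝ≥0∞) := fun j hj => by
    simp only [hS, if_pos hj]
    refine (Metric.ediam_cthickening_le (t m + η)).trans ?_
    gcongr
    exact (hG j hj).ediam_le
  refine ⟨S, fun x hx => ?_, fun j => ?_, ?_⟩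
  · obtain ⟨y, hyB, hy⟩ := hF x hx
    obtain ⟨j, hj, i, hi, z, hz, hyz⟩ := hGT y hyB
    refine Set.mem_biUnion (Finset.mem_range.2 (hj.trans hmK)) ?_
    simp only [hS, if_pos hj]
    refine Metric.mem_cthickening_of_edist_le x z _ _ (Set.mem_biUnion hi hz) ?_
    have hxy : edist x y ≤ η := by
      rw [edist_comm]; exact (Metric.mem_eball.1 (by rwa [Metric.eball_coe])).le
    calc edist x z ≤ edist x y + edist y z := edist_triangle _ _ _
      _ ≤ η + t m := add_le_add hxy hyz
      _ = ENNReal.ofReal (t m + η) := by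
        rw [add_comm, ← NNReal.coe_add, ENNReal.ofReal_coe_nnreal, ENNReal.coe_add]
  · by_cases hj : j < m
    · refine (hSd j hj).trans ((add_le_add (hG j hj).sum_le le_rfl).trans ?_)
      -- A block has diameter at most `κ / 4`, and its thickening adds at most `κ / 2`.
      have : 2 * (κ / 8) + 2 * (t m + η) ≤ κ := by
        have h1 := ht m
        rw [← NNReal.coe_le_coe] at h1 hηκ ⊢
        push_cast at h1 hηκ ⊢
        have := κ.coe_nonneg
        linarith
      exact_mod_cast this
    · simp [hS, hj]
  · have hsplit : ∑ j ∈ Finset.range K, Metric.ediam (S j) =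
        ∑ j ∈ Finset.range m, Metric.ediam (S j) := by
      refine (Finset.sum_subset (Finset.range_mono hmK.le) fun j _ hj => ?_).symm
      have hj' : ¬ j < m := by simpa using hj
      simp [hS, hj']
    rw [hsplit]
    calc ∑ j ∈ Finset.range m, Metric.ediam (S j)
        ≤ ∑ j ∈ Finset.range m,
          (∑ i ∈ G j, Metric.ediam (U i) + 2 * ((t m + η : ℝ≥0) : ℝ≥0∞)) :=
          Finset.sum_le_sum fun j hj => hSd j (Finset.mem_range.1 hj)
      _ ≤ (α + (κ / 8 : ℝ≥0)) + m * (2 * ((t m + η : ℝ≥0) : ℝ≥0∞)) := by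
        rw [Finset.sum_add_distrib, Finset.sum_const, Finset.card_range, nsmul_eq_mul]
        gcongr
        exact hGs.trans hUs
      _ ≤ α + κ := by
        -- The surplus is `κ / 8` from the cover and at most `κ / 4` each from `2 * m * t m` and `2
        -- * m * η`.
        have : (α + κ / 8) + m * (2 * (t m + η)) ≤ α + κ := by
          have hm : (m : ℝ≥0) * η ≤ K * η := by gcongr
          rw [← NNReal.coe_le_coe] at hKη hmt hm ⊢
          push_cast at hKη hmt hm ⊢
          have := κ.coe_nonneg
          nlinarith
        exact_mod_cast this

/-! ### Compactness: from finite subsets to the whole set -/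

/-- If all finite subsets of `A` have covers by `N` sets of diameter at most `δ` and total diameter
at most `s`, then so has `A`. -/
theorem outerLinearPre_le_of_finite {X : Type*} [MetricSpace X] {A : Set X} {N : ℕ} {δ : ℝ}
    {s : ℝ≥0∞}
    (h : ∀ F : Finset X, (F : Set X) ⊆ A → ∃ S : ℕ → Set X,
      (F : Set X) ⊆ ⋃ i ∈ Finset.range N, S i ∧ (∀ i, Metric.ediam (S i) ≤ ENNReal.ofReal δ) ∧
        ∑ i ∈ Finset.range N, Metric.ediam (S i) ≤ s) :
    outerLinearPre δ A ≤ s := by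
  classical
  choose S hFS hSd hSs using fun F : Finset A =>
    h (F.map (Function.Embedding.subtype _)) (by intro x; simp; tauto)
  set u : Ultrafilter (Finset A) := Ultrafilter.of atTop
  have hu : (u : Filter (Finset A)) ≤ atTop := Ultrafilter.of_le _
  have hlim : ∀ i, ∃ D : ℝ≥0∞, Tendsto (fun F => Metric.ediam (S F i)) u (𝓝 D) := fun i => by
    obtain ⟨D, -, hD⟩ := isCompact_univ.ultrafilter_le_nhds
      (u.map fun F => Metric.ediam (S F i)) (by simp)
    exact ⟨D, hD⟩
  choose D hD using hlim
  set E : ℕ → Set X := fun i =>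
    if i < N then {x | ∀ᶠ F in u, x ∈ S F i} else ∅ with hE
  have hED : ∀ i, Metric.ediam (E i) ≤ D i := fun i => by
    refine Metric.ediam_le fun x hx y hy => ?_
    by_cases hi : i < N
    · simp only [hE, if_pos hi, Set.mem_ofPred_eq] at hx hy
      refine ge_of_tendsto (hD i) ?_
      filter_upwards [hx, hy] with F hx hy using Metric.edist_le_ediam_of_mem hx hy
    · simp [hE, hi] at hx
  have hEN : ∀ i ∉ Finset.range N, Metric.ediam (E i) = 0 := fun i hi => by
    have hi' : ¬ i < N := by simpa using hi
    simp [hE, hi']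
  have hAE : A ⊆ ⋃ i, E i := fun x hx => by
    -- Eventually `x ∈ F`, so some `S F i` with `i < N` contains `x`; as there are only finitely
    -- many indices, the ultrafilter selects one `i` that works eventually.
    have hx' : ∀ᶠ F in u, ∃ i ∈ Finset.range N, x ∈ S F i := by
      filter_upwards [hu (eventually_ge_atTop {⟨x, hx⟩})] with F hF
      have := hFS F (show x ∈ _ by simpa [hx] using hF)
      simpa using this
    obtain ⟨i, hi, hxi⟩ := (Ultrafilter.eventually_exists_mem_iff (Finset.finite_toSet _)).1 hx'
    refine Set.mem_iUnion.2 ⟨i, ?_⟩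
    have hi' : i < N := by simpa using hi
    simp only [hE, if_pos hi']
    exact hxi
  have hEd : ∀ i, Metric.ediam (E i) ≤ ENNReal.ofReal δ := fun i =>
    (hED i).trans (le_of_tendsto (hD i) (Eventually.of_forall fun F => hSd F i))
  calc outerLinearPre δ A ≤ ∑' i, Metric.ediam (E i) := iInf₂_le_of_le E hAE (iInf_le _ hEd)
    _ = ∑ i ∈ Finset.range N, Metric.ediam (E i) := tsum_eq_sum hEN
    _ ≤ s := (Finset.sum_le_sum fun i _ => hED i).trans
      (le_of_tendsto (tendsto_finsetSum _ fun i _ => hD i) (Eventually.of_forall hSs))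

/-! ### Detecting length by finitely many open sets -/

/-- Every lower bound of the outer linear measure of a set is inherited by the connected sets that
hit a suitable finite collection of open sets. -/
theorem exists_finite_hits_lt {X : Type*} [MetricSpace X] {A : Set X} {a : ℝ≥0∞}
    (ha : a < outerLinear A) :
    ∃ 𝓤 : Set (Set X), 𝓤.Finite ∧ (∀ U ∈ 𝓤, IsOpen U) ∧ Hits A 𝓤 ∧
      ∀ B : Set X, IsPreconnected B → Hits B 𝓤 → a < outerLinear B := by
  lift a to ℝ≥0 using ha.ne_top
  obtain ⟨δ, hδ⟩ := lt_iSup_iff.1 ha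
  obtain ⟨hδ0, haδ⟩ := lt_iSup_iff.1 hδ
  obtain ⟨ε, hε0, hε⟩ := ENNReal.lt_iff_exists_add_pos_lt.1 haδ
  -- A single `κ` keeps both the diameters below `δ` and the surplus below `ε`.
  set κ : ℝ≥0 := min ε δ.toNNReal with hκ
  have hκ0 : 0 < κ := lt_min hε0 (by simpa using hδ0)
  obtain ⟨N, η, hη, hN⟩ := exists_cover_of_near_isPreconnected X a hκ0
  have hex : ∃ F : Finset X, (F : Set X) ⊆ A ∧ ¬ ∃ S : ℕ → Set X,
      (F : Set X) ⊆ ⋃ i ∈ Finset.range N, S i ∧ (∀ i, Metric.ediam (S i) ≤ ENNReal.ofReal δ) ∧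
        ∑ i ∈ Finset.range N, Metric.ediam (S i) ≤ a + ε := by
    by_contra hcon
    push Not at hcon
    exact absurd hε (outerLinearPre_le_of_finite fun F hF => hcon F hF).not_gt
  obtain ⟨F, hFA, hF⟩ := hex
  refine ⟨(fun x => Metric.ball x η) '' F, F.finite_toSet.image _, ?_, ?_, fun B hB hBF => ?_⟩
  · rintro _ ⟨x, -, rfl⟩
    exact Metric.isOpen_ball
  · rintro _ ⟨x, hx, rfl⟩
    exact ⟨x, hFA hx, Metric.mem_ball_self hη⟩
  · by_contra hle
    obtain ⟨S, hS, hSd, hSs⟩ := hN B hB (not_lt.1 hle) F fun x hx => hBF _ ⟨x, hx, rfl⟩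
    refine hF ⟨S, hS, fun i => (hSd i).trans ?_, hSs.trans ?_⟩
    · exact ENNReal.coe_le_coe.2 (min_le_right _ _)
    · gcongr
      exact min_le_left _ _

theorem exists_finite_hits_lt_add {X : Type*} [MetricSpace X] {A : Set X}
    (hA : outerLinear A < ∞) {ε : ℝ} (hε : 0 < ε) :
    ∃ 𝓤 : Set (Set X), 𝓤.Finite ∧ (∀ U ∈ 𝓤, IsOpen U) ∧ Hits A 𝓤 ∧
      ∀ B : Set X, IsPreconnected B → Hits B 𝓤 →
        outerLinear A < outerLinear B + ENNReal.ofReal ε := by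
  have hε' : 0 < ENNReal.ofReal ε := ENNReal.ofReal_pos.2 hε
  -- Length zero is separate because truncated subtraction then gives nothing strictly below
  -- `outerLinear A`.
  rcases eq_or_ne (outerLinear A) 0 with h0 | h0
  · exact ⟨∅, Set.finite_empty, by simp, by simp [Hits], fun B _ _ => by
      rw [h0]; exact hε'.trans_le le_add_self⟩
  · obtain ⟨𝓤, h₁, h₂, h₃, h₄⟩ := exists_finite_hits_lt (ENNReal.sub_lt_self hA.ne h0 hε'.ne')
    refine ⟨𝓤, h₁, h₂, h₃, fun B hB hBU => ?_⟩
    exact (le_tsub_add).trans_lt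
      ((ENNReal.add_lt_add_iff_right ENNReal.ofReal_ne_top).2 (h₄ B hB hBU))

/-! ### Excess and limits along filters -/

/-- A set close in excess to `A` hits every given finite collection of open sets hit by `A`. -/
theorem exists_forall_excess_lt_hits {X : Type*} [MetricSpace X] {A : Set X} {𝓤 : Set (Set X)}
    (hfin : 𝓤.Finite) (hopen : ∀ U ∈ 𝓤, IsOpen U) (hA : Hits A 𝓤) :
    ∃ δ : ℝ, 0 < δ ∧ ∀ B : Set X, excess A B < ENNReal.ofReal δ → Hits B 𝓤 := by
  have hU : ∀ U ∈ 𝓤, ∃ r : ℝ, 0 < r ∧ ∀ B : Set X, excess A B < ENNReal.ofReal r →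
      (B ∩ U).Nonempty := fun U hU => by
    obtain ⟨a, haA, haU⟩ := hA U hU
    obtain ⟨r, hr, hrU⟩ := Metric.isOpen_iff.1 (hopen U hU) a haU
    refine ⟨r, hr, fun B hB => ?_⟩
    have : Metric.infEDist a B < ENNReal.ofReal r :=
      (le_iSup₂ (f := fun a (_ : a ∈ A) => Metric.infEDist a B) a haA).trans_lt hB
    obtain ⟨b, hb, hab⟩ := Metric.infEDist_lt_iff.1 this
    refine ⟨b, hb, hrU ?_⟩
    rw [← Metric.eball_ofReal, Metric.mem_eball, edist_comm]
    exact hab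
  induction 𝓤, hfin using Set.Finite.induction_on with
  | empty => exact ⟨1, one_pos, fun B _ => by simp [Hits]⟩
  | @insert U 𝓤 _ _ ih =>
    obtain ⟨δ, hδ, h⟩ := ih (fun V hV => hopen V (.inr hV)) (fun V hV => hA V (.inr hV))
      (fun V hV => hU V (.inr hV))
    obtain ⟨r, hr, h'⟩ := hU U (.inl rfl)
    refine ⟨min δ r, lt_min hδ hr, fun B hB => ?_⟩
    rintro V (rfl | hV)
    · exact h' B (hB.trans_le (ENNReal.ofReal_le_ofReal (min_le_right _ _)))
    · exact h B (hB.trans_le (ENNReal.ofReal_le_ofReal (min_le_left _ _))) V hV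

/-- Lower semicontinuity along a filter: if a family of connected sets eventually hits every open
set hit by `A`, its lower limit of lengths is at least the length of `A`. -/
theorem outerLinear_le_liminf {X : Type*} [MetricSpace X] {A : Set X} {Λ : Type*} {l : Filter Λ}
    {C : Λ → Set X} (hC : ∀ i, IsPreconnected (C i))
    (h : ∀ U : Set X, IsOpen U → (A ∩ U).Nonempty → ∀ᶠ i in l, (C i ∩ U).Nonempty) :
    outerLinear A ≤ liminf (fun i => outerLinear (C i)) l := by
  refine le_of_forall_lt fun a ha => ?_
  -- A lower limit preserves only non-strict bounds; the intermediate `b` restores strictness.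
  obtain ⟨b, hab, hb⟩ := exists_between ha
  obtain ⟨𝓤, hfin, hopen, hA, hB⟩ := exists_finite_hits_lt hb
  refine hab.trans_le (le_liminf_of_le (by isBoundedDefault) ?_)
  have : ∀ᶠ i in l, ∀ U ∈ 𝓤, (C i ∩ U).Nonempty :=
    (eventually_all_finite hfin).2 fun U hU => h U (hopen U hU) (hA U hU)
  filter_upwards [this] with i hi using (hB _ (hC i) hi).le

end Golab

/-- Strongest form of Gołąb's theorem, the resulting lower semicontinuity for the lower Vietoris
topology, and the Gołąb, Frink, Bognár and Fremlin versions. Connected subsets are `IsPreconnected`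
sets, so that the empty set is allowed as well; this only strengthens each part. -/
theorem mainTheorem2 (X : Type*) [MetricSpace X] :
    -- finite case of the main statement
    (∀ A : Set X, Golab.outerLinear A < ∞ → ∀ ε : ℝ, 0 < ε →
      ∃ 𝓤 : Set (Set X), 𝓤.Finite ∧ (∀ U ∈ 𝓤, IsOpen U) ∧ Golab.Hits A 𝓤 ∧
        ∀ B : Set X, IsPreconnected B → Golab.Hits B 𝓤 →
          Golab.outerLinear A < Golab.outerLinear B + ENNReal.ofReal ε) ∧
    -- infinite case of the main statement
    (∀ A : Set X, Golab.outerLinear A = ∞ → ∀ M : ℝ, 0 < M →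
      ∃ 𝓤 : Set (Set X), 𝓤.Finite ∧ (∀ U ∈ 𝓤, IsOpen U) ∧ Golab.Hits A 𝓤 ∧
        ∀ B : Set X, IsPreconnected B → Golab.Hits B 𝓤 →
          ENNReal.ofReal M < Golab.outerLinear B) ∧
    -- lower semicontinuity on connected sets for the lower Vietoris topology
    (@LowerSemicontinuousOn (Set X) ℝ≥0∞ (Golab.lowerVietoris X) _ Golab.outerLinear
      {C : Set X | IsPreconnected C}) ∧
    -- Gołąb's version
    (∀ (A : Set X) (C : ℕ → Set X), (∀ n, IsPreconnected (C n)) →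
      Tendsto (fun n => Golab.excess A (C n)) atTop (𝓝 0) →
      Golab.outerLinear A ≤ liminf (fun n => Golab.outerLinear (C n)) atTop) ∧
    -- Frink's version, finite case
    (∀ A : Set X, Golab.outerLinear A < ∞ → ∀ ε : ℝ, 0 < ε →
      ∃ δ : ℝ, 0 < δ ∧ ∀ B : Set X, IsPreconnected B → Golab.excess A B < ENNReal.ofReal δ →
        Golab.outerLinear A < Golab.outerLinear B + ENNReal.ofReal ε) ∧
    -- Frink's version, infinite case
    (∀ A : Set X, Golab.outerLinear A = ∞ → ∀ M : ℝ, 0 < M →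
      ∃ δ : ℝ, 0 < δ ∧ ∀ B : Set X, IsPreconnected B → Golab.excess A B < ENNReal.ofReal δ →
        ENNReal.ofReal M < Golab.outerLinear B) ∧
    -- Bognár's version, for nets
    (∀ (Λ : Type*) [Preorder Λ] [IsDirectedOrder Λ] [Nonempty Λ] (C : Λ → Set X),
      (∀ l, IsPreconnected (C l)) →
      Golab.outerLinear (Golab.lowerLimit C) ≤
        liminf (fun l => Golab.outerLinear (C l)) atTop) ∧
    -- Fremlin's version
    (∀ (A : Set X) (α : ℝ≥0),
      (∀ 𝓤 : Set (Set X), 𝓤.Finite → (∀ U ∈ 𝓤, IsOpen U) → Golab.Hits A 𝓤 →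
        ∃ C : Set X, IsPreconnected C ∧ Golab.Hits C 𝓤 ∧ Golab.outerLinear C ≤ α) →
      Golab.outerLinear A ≤ α) := by
  refine ⟨fun A hA ε hε => Golab.exists_finite_hits_lt_add hA hε,
    fun A hA M _ => Golab.exists_finite_hits_lt (hA ▸ ENNReal.ofReal_lt_top), ?_,
    fun A C hC hlim => ?_, fun A hA ε hε => ?_, fun A hA M _ => ?_, ?_, fun A α h => ?_⟩
  · intro A _ a ha
    obtain ⟨𝓤, hfin, hopen, hA, hB⟩ := Golab.exists_finite_hits_lt ha
    let _ := Golab.lowerVietoris X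
    -- Hitting a finite open collection is a finite intersection of subbasic open conditions.
    have hev : ∀ᶠ S in 𝓝 A, ∀ U ∈ 𝓤, (S ∩ U).Nonempty :=
      (eventually_all_finite hfin).2 fun U hU =>
        (TopologicalSpace.isOpen_generateFrom_of_mem ⟨U, hopen U hU, rfl⟩ :
          IsOpen {S : Set X | (S ∩ U).Nonempty}).mem_nhds (hA U hU)
    filter_upwards [nhdsWithin_le_nhds hev, self_mem_nhdsWithin] with S hS hSc using hB S hSc hS
  · refine Golab.outerLinear_le_liminf hC fun U hU hAU => ?_
    obtain ⟨δ, hδ, h⟩ := Golab.exists_forall_excess_lt_hits (A := A) (Set.finite_singleton U)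
      (by simpa using hU) (by simpa [Golab.Hits] using hAU)
    filter_upwards [hlim.eventually_lt_const (ENNReal.ofReal_pos.2 hδ)] with n hn
    exact h _ hn U rfl
  · obtain ⟨𝓤, hfin, hopen, hA', hB⟩ := Golab.exists_finite_hits_lt_add hA hε
    obtain ⟨δ, hδ, h⟩ := Golab.exists_forall_excess_lt_hits hfin hopen hA'
    exact ⟨δ, hδ, fun B hBc hBe => hB B hBc (h B hBe)⟩
  · obtain ⟨𝓤, hfin, hopen, hA', hB⟩ :=
      Golab.exists_finite_hits_lt (hA ▸ ENNReal.ofReal_lt_top : ENNReal.ofReal M < _)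
    obtain ⟨δ, hδ, h⟩ := Golab.exists_forall_excess_lt_hits hfin hopen hA'
    exact ⟨δ, hδ, fun B hBc hBe => hB B hBc (h B hBe)⟩
  · intro Λ _ _ _ C hC
    refine Golab.outerLinear_le_liminf hC fun U hU ⟨x, hx, hxU⟩ => ?_
    obtain ⟨r, hr, hrU⟩ := Metric.isOpen_iff.1 hU x hxU
    obtain ⟨l₀, hl₀⟩ := hx r hr
    filter_upwards [eventually_ge_atTop l₀] with l hl
    exact (hl₀ l hl).mono (Set.inter_subset_inter_right _ hrU)
  · by_contra hlt
    obtain ⟨𝓤, hfin, hopen, hA, hB⟩ := Golab.exists_finite_hits_lt (not_le.1 hlt)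
    obtain ⟨C, hC, hCU, hCα⟩ := h 𝓤 hfin hopen hA
    exact (hB C hC hCU).not_ge hCα
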